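/- For an irrational point $\alpha\in\mathbb{R}/\mathbb{Z}$, identified with its representative in $(0,1)$, let $[0;a_1,a_2,\dots]$ be its simple continued fraction expansion, put $p_{-1}=1$, $q_{-1}=0$, $p_0=0$, $q_0=1$, and $p_n=a_np_{n-1}+p_{n-2}$, $q_n=a_nq_{n-1}+q_{n-2}$ for $n\ge 1$ (all depending on $\alpha$). For $n\ge 1$ let $$E_n(\alpha)=\left\{\frac{mp_{n-1}+p_{n-2}}{mq_{n-1}+q_{n-2}} : m=1,2,\dots,a_n\right\},$$ regarded as a finite subset of $\mathbb{Q}/\mathbb{Z}$. Let $F:\mathbb{R}/\mathbb{Z}\to\mathbb{R}\cup\{\pm\infty\}$ be a Borel measurable function that is finite almost everywhere with respect to the normalized Haar measure. Then there exist real numbers $c(\beta)$, $\beta\in\mathbb{Q}/\mathbb{Z}$, such that $$\lim_{N\to\infty}\sum_{n=1}^N(-1)^{n-1}q_{n-1}(\alpha)\sum_{\beta\in E_n(\alpha)}c(\beta)=F(\alpha)$$ for almost all irrational points $\alpha\in\mathbb{R}/\mathbb{Z}$. -/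

import Mathlib

open MeasureTheory Filter Topology

namespace IntermediateConvergents

/-- The representative in `[0, 1)` of a point of `ℝ/ℤ`. -/
noncomputable def rep (α : UnitAddCircle) : ℝ := (AddCircle.equivIco (1 : ℝ) 0 α : ℝ)

/-- The partial quotient `a_n` of the simple continued fraction expansion of a real number `x`
(with the value `0` past the end of the expansion, which happens only for rational `x`). -/
noncomputable def partialQuotient (x : ℝ) (n : ℕ) : ℤ :=
  (GenContFract.IntFractPair.stream x n).elim 0 fun P => P.b

/-- Numerators of the principal convergents, with the index shifted by one:
`num x n` is `p_{n-1}`, so that `p_{-1} = 1`, `p_0 = a_0` and `p_n = a_n p_{n-1} + p_{n-2}`. -/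
noncomputable def num (x : ℝ) : ℕ → ℤ
  | 0 => 1
  | 1 => partialQuotient x 0
  | n + 2 => partialQuotient x (n + 1) * num x (n + 1) + num x n

/-- Denominators of the principal convergents, with the index shifted by one:
`den x n` is `q_{n-1}`, so that `q_{-1} = 0`, `q_0 = 1` and `q_n = a_n q_{n-1} + q_{n-2}`. -/
noncomputable def den (x : ℝ) : ℕ → ℤ
  | 0 => 0
  | 1 => 1
  | n + 2 => partialQuotient x (n + 1) * den x (n + 1) + den x n

open Classical in
/-- For `n ≥ 1`, the set
`E_n = { (m p_{n-1} + p_{n-2}) / (m q_{n-1} + q_{n-2}) : m = 1, …, a_n }`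
of convergents and intermediate convergents, as a finite subset of `ℚ/ℤ = AddCircle (1 : ℚ)`. -/
noncomputable def E (x : ℝ) : ℕ → Finset (AddCircle (1 : ℚ))
  | 0 => ∅
  | n + 1 => (Finset.Icc (1 : ℤ) (partialQuotient x (n + 1))).image fun m =>
      ((((m * num x (n + 1) + num x n : ℤ) : ℚ) / ((m * den x (n + 1) + den x n : ℤ) : ℚ) : ℚ) :
        AddCircle (1 : ℚ))

/-- The partial sum `∑_{n=1}^N (-1)^{n-1} q_{n-1} ∑_{β ∈ E_n} c(β)`. -/
noncomputable def partialSum (c : AddCircle (1 : ℚ) → ℝ) (x : ℝ) (N : ℕ) : ℝ :=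
  ∑ n ∈ Finset.Icc 1 N, (-1) ^ (n - 1) * (den x n : ℝ) * ∑ β ∈ E x n, c β

end IntermediateConvergents

namespace IntermediateConvergents

/-! By a theorem of Luzin, F agrees almost everywhere with the derivative of some function G
(`exists_ae_hasDerivAt`). Put w(a/q) = q G(a/q) and let c(β) be w at β minus w at its two Farey
parents. The parents are determined by β (`IsFareyPair.unique`), so c does not depend on α.

The parents of an intermediate convergent are p_{n-1}/q_{n-1} and the preceding intermediate
fraction. Hence the sum of c over E_n telescopes in m, and multiplied by q_{n-1} it becomes X_n +
X_{n-1}, where X_n = q_n q_{n-1} (G(p_n/q_n) - G(p_{n-1}/q_{n-1})). The alternating sum over n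
telescopes again and leaves ±X_N. As p_N q_{N-1} - p_{N-1} q_N = ±1, this is exactly the slope of G
between two consecutive convergents. They lie on opposite sides of α and tend to α, so the slope
tends to G'(α) = F(α) wherever that derivative exists. -/

/-! ### Luzin's theorem: measurable functions as derivatives -/

/-- The primitive of `g`, restarted at `0` at every point of the mesh `η ℤ`. -/
noncomputable def restartedPrimitive (g : ℝ → ℝ) (η : ℝ) (y : ℝ) : ℝ :=
  ∫ t in (η * ⌊y / η⌋)..y, g t

theorem ae_hasDerivAt_restartedPrimitive {g : ℝ → ℝ} (hg : Integrable g) {η : ℝ} (hη : 0 < η) :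
    ∀ᵐ x, HasDerivAt (restartedPrimitive g η) (g x) x := by
  have hnull : ∀ᵐ x : ℝ, x ∉ Set.range fun k : ℤ => η * (k : ℝ) :=
    (Set.countable_range _).ae_notMem volume
  filter_upwards [LocallyIntegrable.ae_hasDerivAt_integral hg.locallyIntegrable, hnull] with x hx hmesh
  have hfl : ∀ᶠ y in 𝓝 x, ⌊y / η⌋ = ⌊x / η⌋ := by
    have hlt : (⌊x / η⌋ : ℝ) < x / η := by
      refine lt_of_le_of_ne (Int.floor_le _) fun h => hmesh ⟨⌊x / η⌋, ?_⟩
      simp only [h]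
      field_simp
    have hc : ContinuousAt (fun y : ℝ => y / η) x := by fun_prop
    filter_upwards [hc.eventually_const_lt hlt, hc.eventually_lt_const (Int.lt_floor_add_one (x / η))]
      with y h1 h2
    exact Int.floor_eq_iff.2 ⟨h1.le, h2⟩
  refine (hx (η * ⌊x / η⌋)).congr_of_eventuallyEq ?_
  filter_upwards [hfl] with y hy
  rw [restartedPrimitive, hy]

theorem abs_restartedPrimitive_le {g : ℝ → ℝ} {M : ℝ} (hM : ∀ t, |g t| ≤ M)
    {η : ℝ} (hη : 0 < η) (y : ℝ) : |restartedPrimitive g η y| ≤ M * η := by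
  have h1 : η * ⌊y / η⌋ ≤ y := by
    have := mul_le_mul_of_nonneg_left (Int.floor_le (y / η)) hη.le
    rwa [mul_div_cancel₀ _ hη.ne'] at this
  have h2 : y ≤ η * ⌊y / η⌋ + η := by
    have := mul_le_mul_of_nonneg_left (Int.lt_floor_add_one (y / η)).le hη.le
    rw [mul_div_cancel₀ _ hη.ne'] at this
    linarith
  have hM0 : 0 ≤ M := (abs_nonneg _).trans (hM 0)
  calc |restartedPrimitive g η y| ≤ M * |y - η * ⌊y / η⌋| := by
        rw [← Real.norm_eq_abs]
        exact intervalIntegral.norm_integral_le_of_norm_le_const fun t _ => hM t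
    _ ≤ M * η := by
        rw [abs_of_nonneg (by linarith)]
        exact mul_le_mul_of_nonneg_left (by linarith) hM0

theorem exists_mem_of_restartedPrimitive_ne_zero {g : ℝ → ℝ} {K : Set ℝ}
    (hg : ∀ t ∉ K, g t = 0) {η : ℝ} (hη : 0 < η) {y : ℝ} (hy : restartedPrimitive g η y ≠ 0) :
    ∃ z ∈ K, |y - z| ≤ η := by
  by_contra! h
  have h1 : η * ⌊y / η⌋ ≤ y := by
    have := mul_le_mul_of_nonneg_left (Int.floor_le (y / η)) hη.le
    rwa [mul_div_cancel₀ _ hη.ne'] at this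
  have h2 : y ≤ η * ⌊y / η⌋ + η := by
    have := mul_le_mul_of_nonneg_left (Int.lt_floor_add_one (y / η)).le hη.le
    rw [mul_div_cancel₀ _ hη.ne'] at this
    linarith
  refine hy (intervalIntegral.integral_zero_ae (ae_of_all _ fun t ht => hg t fun hK => ?_))
  rw [Set.uIoc_of_le h1] at ht
  have := h t hK
  rw [abs_of_nonneg (by linarith [ht.2])] at this
  linarith [ht.1]

/-- A primitive restarted on a fine mesh is uniformly small and vanishes away from `K`, hence near
`Q`. Its jumps are harmless: the mesh is a null set and G need not be continuous. -/
theorem exists_ae_hasDerivAt_indicator_of_disjoint {f : ℝ → ℝ} (hf : Measurable f) {K Q : Set ℝ}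
    (hK : IsCompact K) (hQ : IsCompact Q) (hKQ : Disjoint K Q) {M : ℝ} (hM : ∀ t ∈ K, |f t| ≤ M)
    {ε : ℝ} (hε : 0 < ε) :
    ∃ G : ℝ → ℝ, (∀ᵐ x, HasDerivAt G (K.indicator f x) x) ∧
      ∀ x ∈ Q, ∀ y, |G y| ≤ ε * (y - x) ^ 2 := by
  obtain ⟨r, hr, hsep⟩ := Metric.exists_pos_forall_lt_edist hK hQ.isClosed hKQ
  have hsep' : ∀ z ∈ K, ∀ x ∈ Q, (r : ℝ) < |z - x| := by
    intro z hz x hx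
    have := hsep z hz x hx
    rw [edist_nndist, ENNReal.coe_lt_coe] at this
    rw [← Real.dist_eq]
    exact_mod_cast this
  have hr' : (0 : ℝ) < r := by exact_mod_cast hr
  -- `M` may be zero, or negative when `K` is empty; `C` is a positive bound valid off `K` too.
  set C : ℝ := |M| + 1 with hC
  have hC0 : 0 < C := by positivity
  have hb : ∀ t, |K.indicator f t| ≤ C := by
    intro t
    by_cases ht : t ∈ K
    · rw [Set.indicator_of_mem ht]
      linarith [hM t ht, le_abs_self M]
    · rw [Set.indicator_of_notMem ht, abs_zero]
      exact hC0.le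
  have hint : Integrable (K.indicator f) := by
    rw [integrable_indicator_iff hK.measurableSet]
    refine Measure.integrableOn_of_bounded (M := M) hK.measure_lt_top.ne hf.aestronglyMeasurable ?_
    exact (ae_restrict_iff' hK.measurableSet).2 (ae_of_all _ hM)
  -- The first entry keeps the support at distance at least r/2 from `Q`; the second gives C η ≤ ε
  -- (r/2)².
  set η : ℝ := min (r / 2) (ε * (r / 2) ^ 2 / C) with hηdef
  have hη : 0 < η := by positivity
  refine ⟨restartedPrimitive (K.indicator f) η, ae_hasDerivAt_restartedPrimitive hint hη, ?_⟩
  intro x hx y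
  by_cases h0 : restartedPrimitive (K.indicator f) η y = 0
  · rw [h0, abs_zero]
    positivity
  obtain ⟨z, hz, hyz⟩ := exists_mem_of_restartedPrimitive_ne_zero
    (fun t ht => Set.indicator_of_notMem ht f) hη h0
  have h1 : (r : ℝ) / 2 ≤ |y - x| := by
    have h2 := hsep' z hz x hx
    have h3 : |z - x| ≤ |y - z| + |y - x| := by
      rw [abs_sub_comm y z]
      exact abs_sub_le z y x
    have h4 : η ≤ r / 2 := min_le_left _ _
    linarith
  calc |restartedPrimitive (K.indicator f) η y| ≤ C * η := abs_restartedPrimitive_le hb hη y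
    _ ≤ C * (ε * (r / 2) ^ 2 / C) := mul_le_mul_of_nonneg_left (min_le_right _ _) hC0.le
    _ = ε * (r / 2) ^ 2 := by field_simp
    _ ≤ ε * (y - x) ^ 2 := by
        rw [← sq_abs (y - x)]
        gcongr

/-- Up to a null set, the real line is the increasing union of compact sets `Q n`, where
`Q (n + 1)` is the disjoint union of `Q n` and a compact set `K n` on which `|f| ≤ n`. -/
theorem exists_disjoint_compacts_bounded {f : ℝ → ℝ} (hf : Measurable f) :
    ∃ K Q : ℕ → Set ℝ, Q 0 = ∅ ∧ (∀ n, Q (n + 1) = Q n ∪ K n) ∧ (∀ n, IsCompact (K n)) ∧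
      (∀ n, IsCompact (Q n)) ∧ (∀ n, Disjoint (K n) (Q n)) ∧ (∀ n, ∀ t ∈ K n, |f t| ≤ n) ∧
      ∀ᵐ x, ∃ n, x ∈ Q n := by
  set A : ℕ → Set ℝ := fun n => Set.Icc (-n : ℝ) n ∩ {t | |f t| ≤ n} with hA
  have hAm : ∀ n, MeasurableSet (A n) := fun n =>
    measurableSet_Icc.inter (measurableSet_le hf.abs measurable_const)
  have key : ∀ (n : ℕ) (S : Set ℝ), ∃ K, IsCompact S → K ⊆ A n \ S ∧ IsCompact K ∧
      volume ((A n \ S) \ K) < ENNReal.ofReal (1 / (n + 1)) := by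
    intro n S
    by_cases hS : IsCompact S
    · obtain ⟨K, h1, h2, h3⟩ := ((hAm n).diff hS.measurableSet).exists_isCompact_sdiff_lt
        (μ := volume) (ε := ENNReal.ofReal (1 / (n + 1)))
        (((measure_mono (Set.sdiff_subset.trans Set.inter_subset_left)).trans_lt
          (isCompact_Icc (a := (-n : ℝ)) (b := n)).measure_lt_top).ne)
        (ENNReal.ofReal_pos.2 (by positivity)).ne'
      exact ⟨K, fun _ => ⟨h1, h2, h3⟩⟩
    · exact ⟨∅, fun h => absurd h hS⟩
  choose κ hκ using key
  set Q : ℕ → Set ℝ := fun n => Nat.rec ∅ (fun n S => S ∪ κ n S) n with hQdef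
  have hQs : ∀ n, Q (n + 1) = Q n ∪ κ n (Q n) := fun n => rfl
  have hQ : ∀ n, IsCompact (Q n) := by
    intro n
    induction n with
    | zero => exact isCompact_empty
    | succ n ih =>
      rw [hQs]
      exact ih.union (hκ n _ ih).2.1
  refine ⟨fun n => κ n (Q n), Q, rfl, hQs, fun n => (hκ n _ (hQ n)).2.1, hQ, fun n => ?_,
    fun n t ht => ((hκ n _ (hQ n)).1 ht).1.2, ?_⟩
  · exact Set.disjoint_left.2 fun t ht => ((hκ n _ (hQ n)).1 ht).2
  -- For n ≥ m, the part of `A m` never covered lies in the part of `A n` missed at stage n, whose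
  -- measure is below 1/(n+1).
  · have hz : ∀ m, volume (A m \ ⋃ n, Q n) = 0 := by
      intro m
      have hle : ∀ n ≥ m, volume (A m \ ⋃ n, Q n) ≤ ENNReal.ofReal (1 / ((n : ℝ) + 1)) := by
        intro n hn
        refine (measure_mono ?_).trans (hκ n _ (hQ n)).2.2.le
        rintro t ⟨⟨ht1, ht2⟩, ht3⟩
        have hmn : (m : ℝ) ≤ n := by exact_mod_cast hn
        have hnot : t ∉ Q (n + 1) := fun h => ht3 (Set.mem_iUnion.2 ⟨n + 1, h⟩)
        rw [hQs] at hnot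
        refine ⟨⟨⟨⟨by linarith [ht1.1], by linarith [ht1.2]⟩, le_trans ht2 hmn⟩,
          fun h => hnot (Or.inl h)⟩, fun h => hnot (Or.inr h)⟩
      have hlim : Tendsto (fun n : ℕ => ENNReal.ofReal (1 / ((n : ℝ) + 1))) atTop (𝓝 0) := by
        have := ENNReal.tendsto_ofReal (tendsto_one_div_add_atTop_nhds_zero_nat (𝕜 := ℝ))
        rwa [ENNReal.ofReal_zero] at this
      exact le_antisymm (ge_of_tendsto hlim (eventually_atTop.2 ⟨m, hle⟩)) bot_le
    have hz' : volume (⋃ m, A m \ ⋃ n, Q n) = 0 := measure_iUnion_null hz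
    refine measure_mono_null ?_ hz'
    intro t ht
    obtain ⟨m, hm⟩ := exists_nat_ge (max |t| |f t|)
    have h1 := (le_max_left _ _).trans hm
    refine Set.mem_iUnion.2 ⟨m, ⟨abs_le.1 h1, (le_max_right _ _).trans hm⟩, fun h => ht ?_⟩
    exact Set.mem_iUnion.1 h

/-- A form of Luzin's theorem: a measurable function is almost everywhere a derivative. -/
theorem exists_ae_hasDerivAt {f : ℝ → ℝ} (hf : Measurable f) :
    ∃ G : ℝ → ℝ, ∀ᵐ x, HasDerivAt G (f x) x := by
  obtain ⟨K, Q, hQ0, hQs, hK, hQ, hKQ, hbd, hcover⟩ := exists_disjoint_compacts_bounded hf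
  choose G hG hGle using fun n => exists_ae_hasDerivAt_indicator_of_disjoint hf (hK n) (hQ n)
    (hKQ n) (hbd n) (ε := (1 / 2 : ℝ) ^ n) (by positivity)
  refine ⟨fun y => ∑' n, G n y, ?_⟩
  filter_upwards [hcover, ae_all_iff.2 hG] with x ⟨m, hm⟩ hx
  have hmono : Monotone Q := monotone_nat_of_le_succ fun n => by
    rw [hQs]
    exact Set.subset_union_left
  have hgeo : Summable fun n : ℕ => (1 / 2 : ℝ) ^ n :=
    summable_geometric_of_lt_one (by norm_num) (by norm_num)
  have hle : ∀ y n, |G (n + m) y| ≤ (1 / 2 : ℝ) ^ n * (y - x) ^ 2 := by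
    intro y n
    refine (hGle (n + m) x (hmono (Nat.le_add_left m n) hm) y).trans ?_
    refine mul_le_mul_of_nonneg_right ?_ (sq_nonneg _)
    exact pow_le_pow_of_le_one (by norm_num) (by norm_num) (Nat.le_add_right n m)
  have hsum : ∀ y, Summable fun n => G (n + m) y := fun y =>
    Summable.of_norm_bounded (hgeo.mul_right _) (hle y)
  have htail : ∀ y, |∑' n, G (n + m) y| ≤ 2 * (y - x) ^ 2 := by
    intro y
    have hs := hasSum_geometric_two.mul_right ((y - x) ^ 2)
    exact tsum_of_norm_bounded (f := fun n => G (n + m) y) hs (hle y)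
  have hsplit : (fun y => ∑' n, G n y) =
      fun y => (∑ n ∈ Finset.range m, G n y) + ∑' n, G (n + m) y := by
    funext y
    exact (((summable_nat_add_iff m).1 (hsum y)).sum_add_tsum_nat_add m).symm
  have hsumf : ∀ k, ∑ n ∈ Finset.range k, (K n).indicator f x = (Q k).indicator f x := by
    intro k
    induction k with
    | zero => simp [hQ0]
    | succ k ih =>
      rw [Finset.sum_range_succ, ih, hQs, Set.indicator_union_of_disjoint (hKQ k).symm]
  -- At a point of `Q m`, all terms from index m on are quadratically small with summable constants,
  -- so their sum has derivative zero there.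
  have htail' : HasDerivAt (fun y => ∑' n, G (n + m) y) 0 x := by
    have h0 : ∑' n, G (n + m) x = 0 := by
      have := htail x
      rwa [sub_self, zero_pow two_ne_zero, mul_zero, abs_nonpos_iff] at this
    rw [hasDerivAt_iff_isLittleO, h0]
    refine (Asymptotics.IsBigO.of_bound 2 (Eventually.of_forall fun y => ?_)).trans_isLittleO
      (?_ : (fun y : ℝ => (y - x) ^ 2) =o[𝓝 x] fun y => y - x)
    · simpa using htail y
    · simpa using Asymptotics.isLittleO_pow_sub_sub x one_lt_two
  rw [hsplit]
  have := (HasDerivAt.fun_sum fun n (_ : n ∈ Finset.range m) => hx n).add htail'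
  rwa [hsumf, Set.indicator_of_mem hm, add_zero] at this

/-! ### Straddled slopes, and null sets on the circle -/

/-- Difference quotients over intervals shrinking to `x` and containing `x` tend to the
derivative. -/
theorem tendsto_straddled_slope {G : ℝ → ℝ} {x g : ℝ} (hG : HasDerivAt G g x) {a b : ℕ → ℝ}
    (ha : Tendsto a atTop (𝓝 x)) (hb : Tendsto b atTop (𝓝 x)) (hab : ∀ᶠ n in atTop, a n ≠ b n)
    (hx : ∀ᶠ n in atTop, |a n - x| + |b n - x| ≤ |a n - b n|) :
    Tendsto (fun n => (G (a n) - G (b n)) / (a n - b n)) atTop (𝓝 g) := by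
  rw [Metric.tendsto_atTop']
  intro ε hε
  have hlit := (hasDerivAt_iff_isLittleO.1 hG).bound (half_pos hε)
  obtain ⟨N, hN⟩ := eventually_atTop.1
    ((ha.eventually hlit).and ((hb.eventually hlit).and (hab.and hx)))
  refine ⟨N, fun n hn => ?_⟩
  obtain ⟨h1, h2, h3, h4⟩ := hN n hn.le
  have hne : a n - b n ≠ 0 := sub_ne_zero.2 h3
  simp only [Real.norm_eq_abs, smul_eq_mul] at h1 h2
  have hpos : 0 < |a n - b n| := abs_pos.2 hne
  rw [Real.dist_eq]
  have heq : (G (a n) - G (b n)) / (a n - b n) - g =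
      ((G (a n) - G x - (a n - x) * g) - (G (b n) - G x - (b n - x) * g)) / (a n - b n) := by
    field_simp
    ring
  rw [heq, abs_div, div_lt_iff₀ hpos]
  refine (abs_sub _ _).trans_lt ?_
  nlinarith

theorem quasiMeasurePreserving_rep :
    Measure.QuasiMeasurePreserving rep (volume : Measure UnitAddCircle) volume := by
  have hmeas : Measurable rep :=
    measurable_subtype_coe.comp (AddCircle.measurableEquivIco 1 0).measurable
  refine ⟨hmeas, Measure.AbsolutelyContinuous.mk fun s hs hs0 => ?_⟩
  rw [Measure.map_apply hmeas hs, AddCircle.add_projection_respects_measure 1 0 (hmeas hs)]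
  -- Haar measure is computed on (0, 1] but `rep` takes values in [0, 1), so the endpoint 1 is
  -- discarded.
  refine measure_mono_null (t := s ∪ {1}) ?_ (measure_union_null hs0 (by simp))
  rintro y ⟨hy, hy0, hy1⟩
  rcases eq_or_ne y 1 with rfl | hne
  · exact Or.inr rfl
  · left
    have : rep (y : UnitAddCircle) = y := by
      rw [rep, AddCircle.coe_equivIco_mk_apply]
      simp only [zero_add] at hy1
      rw [div_one, mul_one]
      exact Int.fract_eq_self.2 ⟨hy0.le, lt_of_le_of_ne hy1 hne⟩
    rw [← this]
    exact hy

/-! ### Farey pairs and the coefficients c(β) -/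

/-- `w = (u, v, u', v')` is a Farey pair `u / v < u' / v'` (where `1 / 0 = ∞` is allowed) whose
mediant lies in `(0, 1]` and represents `β`. -/
def IsFareyPair (β : AddCircle (1 : ℚ)) (w : ℤ × ℤ × ℤ × ℤ) : Prop :=
  1 ≤ w.2.1 ∧ 0 ≤ w.2.2.2 ∧ w.2.2.1 * w.2.1 - w.1 * w.2.2.2 = 1 ∧
    0 < w.1 + w.2.2.1 ∧ w.1 + w.2.2.1 ≤ w.2.1 + w.2.2.2 ∧
      ((((w.1 + w.2.2.1 : ℤ) : ℚ) / ((w.2.1 + w.2.2.2 : ℤ) : ℚ) : ℚ) : AddCircle (1 : ℚ)) = β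

theorem den_div_of_mul_sub_mul_eq_one {a q u v : ℤ} (hq : 0 < q) (h : a * v - q * u = 1) :
    (((a : ℚ) / (q : ℚ)).den : ℤ) = q :=
  Rat.den_div_eq_of_coprime hq <| Int.isCoprime_iff_gcd_eq_one.1
    ⟨v, -u, by linear_combination h⟩

theorem eq_of_coe_div_eq {a q u v a' q' u' v' : ℤ} (hq : 0 < q) (hq' : 0 < q')
    (h : a * v - q * u = 1) (h' : a' * v' - q' * u' = 1)
    (hβ : (((a : ℚ) / (q : ℚ) : ℚ) : AddCircle (1 : ℚ)) = (((a' : ℚ) / (q' : ℚ) : ℚ))) :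
    q = q' ∧ q ∣ a - a' := by
  rw [← sub_eq_zero, ← AddCircle.coe_sub, AddCircle.coe_eq_zero_iff] at hβ
  obtain ⟨k, hk⟩ := hβ
  rw [zsmul_one] at hk
  have hadd : (a : ℚ) / q = (a' : ℚ) / q' + k := by linear_combination -hk
  have hqq : q = q' := by
    rw [← den_div_of_mul_sub_mul_eq_one hq h, ← den_div_of_mul_sub_mul_eq_one hq' h', hadd,
      Rat.add_intCast_den]
  subst hqq
  refine ⟨rfl, k, ?_⟩
  have hne : (q : ℚ) ≠ 0 := by exact_mod_cast hq.ne'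
  rw [← sub_div, eq_div_iff hne] at hk
  have : (a : ℚ) - a' = q * k := by linear_combination -hk
  exact_mod_cast this

/-- The mediant a/q is in lowest terms, so β fixes q and the class of a mod q, and 0 < a ≤ q fixes
a. Then a v - q u = 1 fixes v mod q, and 1 ≤ v ≤ q fixes v, hence everything. -/
theorem IsFareyPair.unique {β : AddCircle (1 : ℚ)} {w z : ℤ × ℤ × ℤ × ℤ}
    (hw : IsFareyPair β w) (hz : IsFareyPair β z) : w = z := by
  obtain ⟨u, v, u', v'⟩ := w
  obtain ⟨s, t, s', t'⟩ := z
  obtain ⟨h1, h2, h3, h4, h5, h6⟩ := hw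
  obtain ⟨k1, k2, k3, k4, k5, k6⟩ := hz
  simp only at h1 h2 h3 h4 h5 h6 k1 k2 k3 k4 k5 k6
  have hdet : (u + u') * v - (v + v') * u = 1 := by linear_combination h3
  have kdet : (s + s') * t - (t + t') * s = 1 := by linear_combination k3
  obtain ⟨hq, ha⟩ := eq_of_coe_div_eq (by omega) (by omega) hdet kdet (h6.trans k6.symm)
  have ha' : u + u' = s + s' := by
    have := Int.eq_zero_of_abs_lt_dvd ha (abs_lt.2 ⟨by omega, by omega⟩)
    omega
  rw [← hq, ← ha'] at kdet
  have hcop : IsCoprime (v + v') (u + u') := ⟨-u, v, by linear_combination hdet⟩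
  have hdvd : v + v' ∣ v - t := by
    refine hcop.dvd_of_dvd_mul_left ⟨u - s, ?_⟩
    linear_combination hdet - kdet
  have hv : v - t = 0 := Int.eq_zero_of_abs_lt_dvd hdvd (abs_lt.2 ⟨by omega, by omega⟩)
  have hv' : v = t := by omega
  subst hv'
  have hu : u = s := by
    have : (v + v') * (u - s) = 0 := by linear_combination kdet - hdet
    rcases mul_eq_zero.1 this with h | h <;> omega
  subst hu
  simp only [Prod.mk.injEq, true_and]
  omega

/-- `q G(a / q)`, which vanishes for `q = 0`. -/
noncomputable def weighted (G : ℝ → ℝ) (a q : ℤ) : ℝ := q * G (a / q)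

open Classical in
/-- The second difference of `a / q ↦ q G(a / q)` at the mediant of a Farey pair. -/
noncomputable def fareyCoeff (G : ℝ → ℝ) (β : AddCircle (1 : ℚ)) : ℝ :=
  if h : ∃ w, IsFareyPair β w then
    weighted G (h.choose.1 + h.choose.2.2.1) (h.choose.2.1 + h.choose.2.2.2) -
      weighted G h.choose.1 h.choose.2.1 - weighted G h.choose.2.2.1 h.choose.2.2.2
  else 0

theorem fareyCoeff_eq (G : ℝ → ℝ) {β : AddCircle (1 : ℚ)} {u v u' v' : ℤ}
    (h : IsFareyPair β (u, v, u', v')) :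
    fareyCoeff G β =
      weighted G (u + u') (v + v') - weighted G u v - weighted G u' v' := by
  have hex : ∃ w, IsFareyPair β w := ⟨_, h⟩
  rw [fareyCoeff, dif_pos hex, hex.choose_spec.unique h]

/-! ### Continued fraction of an irrational number -/

/-- The continued fraction algorithm never stops at an irrational number. -/
theorem exists_stream_eq_some {x : ℝ} (hx : Irrational x) (n : ℕ) :
    ∃ P, GenContFract.IntFractPair.stream x n = some P ∧ Irrational P.fr ∧ 0 < P.fr ∧
      P.fr < 1 := by
  have hof : ∀ y : ℝ, Irrational y → Irrational (GenContFract.IntFractPair.of y).fr ∧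
      0 < (GenContFract.IntFractPair.of y).fr ∧ (GenContFract.IntFractPair.of y).fr < 1 := by
    intro y hy
    have hirr : Irrational (Int.fract y) := hy.sub_intCast ⌊y⌋
    exact ⟨hirr, lt_of_le_of_ne (Int.fract_nonneg y) hirr.ne_zero.symm, Int.fract_lt_one y⟩
  induction n with
  | zero => exact ⟨_, rfl, hof x hx⟩
  | succ n ih =>
    obtain ⟨P, hP, hirr, h0, h1⟩ := ih
    exact ⟨_, GenContFract.IntFractPair.stream_succ_of_some hP h0.ne', hof _ hirr.inv⟩

/-- The fractional part at stage `n` of the continued fraction algorithm. -/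
noncomputable def remainder (x : ℝ) (n : ℕ) : ℝ :=
  (GenContFract.IntFractPair.stream x n).elim 0 fun P => P.fr

theorem remainder_pos {x : ℝ} (hx : Irrational x) (n : ℕ) : 0 < remainder x n := by
  obtain ⟨P, hP, -, h0, -⟩ := exists_stream_eq_some hx n
  simpa [remainder, hP] using h0

theorem remainder_lt_one {x : ℝ} (hx : Irrational x) (n : ℕ) : remainder x n < 1 := by
  obtain ⟨P, hP, -, -, h1⟩ := exists_stream_eq_some hx n
  simpa [remainder, hP] using h1

theorem remainder_mul_add {x : ℝ} (hx : Irrational x) (n : ℕ) :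
    remainder x n * (partialQuotient x (n + 1) + remainder x (n + 1)) = 1 := by
  obtain ⟨P, hP, -, h0, -⟩ := exists_stream_eq_some hx n
  have hS := GenContFract.IntFractPair.stream_succ_of_some hP h0.ne'
  simp only [remainder, partialQuotient, hP, hS, Option.elim, GenContFract.IntFractPair.of]
  rw [Int.floor_add_fract, mul_inv_cancel₀ h0.ne']

theorem partialQuotient_zero {x : ℝ} (h0 : 0 < x) (h1 : x < 1) : partialQuotient x 0 = 0 := by
  simp [partialQuotient, GenContFract.IntFractPair.stream, GenContFract.IntFractPair.of,
    Int.floor_eq_zero_iff, h0.le, h1]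

theorem remainder_zero {x : ℝ} (h0 : 0 < x) (h1 : x < 1) : remainder x 0 = x := by
  simp [remainder, GenContFract.IntFractPair.stream, GenContFract.IntFractPair.of,
    Int.fract_eq_self, h0.le, h1]

theorem one_le_partialQuotient {x : ℝ} (hx : Irrational x) (n : ℕ) :
    1 ≤ partialQuotient x (n + 1) := by
  have h := remainder_mul_add hx n
  have h0 := remainder_pos hx n
  have h1 := remainder_lt_one hx n
  have h2 := remainder_lt_one hx (n + 1)
  have : (0 : ℝ) < partialQuotient x (n + 1) := by
    by_contra! hle
    nlinarith
  exact_mod_cast this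

theorem num_succ_mul_den_sub (x : ℝ) (n : ℕ) :
    num x (n + 1) * den x n - num x n * den x (n + 1) = (-1) ^ (n + 1) := by
  induction n with
  | zero => simp [num, den]
  | succ n ih =>
    rw [num, den, pow_succ, ← ih]
    ring

theorem den_nonneg_and_one_le {x : ℝ} (hx : Irrational x) (n : ℕ) :
    0 ≤ den x n ∧ 1 ≤ den x (n + 1) := by
  induction n with
  | zero => simp [den]
  | succ n ih =>
    have ha := one_le_partialQuotient hx n
    rw [den]
    exact ⟨by omega, by nlinarith⟩

theorem den_nonneg {x : ℝ} (hx : Irrational x) (n : ℕ) : 0 ≤ den x n :=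
  (den_nonneg_and_one_le hx n).1

theorem one_le_den_succ {x : ℝ} (hx : Irrational x) (n : ℕ) : 1 ≤ den x (n + 1) :=
  (den_nonneg_and_one_le hx n).2

theorem le_den_succ {x : ℝ} (hx : Irrational x) (n : ℕ) : (n : ℤ) ≤ den x (n + 1) := by
  induction n with
  | zero => simp [den]
  | succ n ih =>
    have ha := one_le_partialQuotient hx n
    have h1 := one_le_den_succ hx n
    rw [den]
    rcases n with _ | n
    · have := den_nonneg hx 0
      push_cast
      nlinarith
    · have := one_le_den_succ hx n
      push_cast at ih ⊢
      nlinarith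

/-- These inequalities put the mediants in (0, 1], as `IsFareyPair` requires. -/
theorem num_bounds {x : ℝ} (hx : Irrational x) (h0 : 0 < x) (h1 : x < 1) (n : ℕ) :
    0 ≤ num x n ∧ 0 ≤ num x (n + 1) ∧ 1 ≤ num x n + num x (n + 1) ∧
      num x (n + 1) ≤ den x (n + 1) ∧ num x n + num x (n + 1) ≤ den x n + den x (n + 1) := by
  induction n with
  | zero => simp [num, den, partialQuotient_zero h0 h1]
  | succ n ih =>
    obtain ⟨k1, k2, k3, k4, k5⟩ := ih
    have ha := one_le_partialQuotient hx n
    have hr : den x (n + 2) = partialQuotient x (n + 1) * den x (n + 1) + den x n := rfl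
    have hs : num x (n + 2) = partialQuotient x (n + 1) * num x (n + 1) + num x n := rfl
    rw [show n + 1 + 1 = n + 2 from rfl, hr, hs]
    refine ⟨k2, ?_, ?_, ?_, ?_⟩ <;> nlinarith

/-- The complete quotient formula. -/
theorem mul_den_add_remainder {x : ℝ} (hx : Irrational x) (h0 : 0 < x) (h1 : x < 1) (n : ℕ) :
    x * (den x (n + 1) + remainder x n * den x n) = num x (n + 1) + remainder x n * num x n := by
  induction n with
  | zero => simp [num, den, partialQuotient_zero h0 h1, remainder_zero h0 h1]
  | succ n ih =>
    have h := remainder_mul_add hx n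
    have hne := (remainder_pos hx n).ne'
    refine mul_left_cancel₀ hne ?_
    simp only [num, den]
    push_cast
    linear_combination ih + (x * den x (n + 1) - num x (n + 1)) * h

/-! ### Intermediate convergents as mediants -/

theorem isFareyPair_of_even {x : ℝ} (hx : Irrational x) (h0 : 0 < x) (h1 : x < 1) {n : ℕ}
    (hn : Even n) {m : ℤ} (hm : 1 ≤ m) :
    IsFareyPair ((((m * num x (n + 1) + num x n : ℤ) : ℚ) /
        ((m * den x (n + 1) + den x n : ℤ) : ℚ) : ℚ) : AddCircle (1 : ℚ))
      (num x (n + 1), den x (n + 1), (m - 1) * num x (n + 1) + num x n,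
        (m - 1) * den x (n + 1) + den x n) := by
  have hd := num_succ_mul_den_sub x n
  rw [hn.add_one.neg_one_pow] at hd
  obtain ⟨k1, k2, k3, k4, k5⟩ := num_bounds hx h0 h1 n
  have hq := den_nonneg hx n
  have hq' := one_le_den_succ hx n
  refine ⟨hq', ?_, ?_, ?_, ?_, ?_⟩ <;> dsimp only
  · nlinarith
  · linear_combination -hd
  · nlinarith
  · nlinarith
  · congr 3 <;> ring

theorem isFareyPair_of_odd {x : ℝ} (hx : Irrational x) (h0 : 0 < x) (h1 : x < 1) {n : ℕ}
    (hn : Odd n) {m : ℤ} (hm : 1 ≤ m) :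
    IsFareyPair ((((m * num x (n + 1) + num x n : ℤ) : ℚ) /
        ((m * den x (n + 1) + den x n : ℤ) : ℚ) : ℚ) : AddCircle (1 : ℚ))
      ((m - 1) * num x (n + 1) + num x n, (m - 1) * den x (n + 1) + den x n,
        num x (n + 1), den x (n + 1)) := by
  have hd := num_succ_mul_den_sub x n
  rw [hn.add_one.neg_one_pow] at hd
  obtain ⟨k1, k2, k3, k4, k5⟩ := num_bounds hx h0 h1 n
  -- Oddness excludes index 0, so the left parent has nonzero denominator even for m = 1; 1/0 occurs
  -- only as a right parent.
  obtain ⟨l, rfl⟩ := Nat.exists_eq_succ_of_ne_zero hn.pos.ne'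
  have hq := one_le_den_succ hx l
  have hq' := one_le_den_succ hx (l + 1)
  simp only [Nat.succ_eq_add_one] at *
  refine ⟨?_, ?_, ?_, ?_, ?_, ?_⟩ <;> dsimp only
  · nlinarith
  · omega
  · linear_combination hd
  · nlinarith
  · nlinarith
  · congr 3 <;> ring

theorem fareyCoeff_intermediate (G : ℝ → ℝ) {x : ℝ} (hx : Irrational x) (h0 : 0 < x) (h1 : x < 1)
    (n : ℕ) {m : ℤ} (hm : 1 ≤ m) :
    fareyCoeff G ((((m * num x (n + 1) + num x n : ℤ) : ℚ) /
        ((m * den x (n + 1) + den x n : ℤ) : ℚ) : ℚ) : AddCircle (1 : ℚ)) =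
      weighted G (m * num x (n + 1) + num x n) (m * den x (n + 1) + den x n) -
        weighted G ((m - 1) * num x (n + 1) + num x n) ((m - 1) * den x (n + 1) + den x n) -
          weighted G (num x (n + 1)) (den x (n + 1)) := by
  rcases Nat.even_or_odd n with hn | hn
  · rw [fareyCoeff_eq G (isFareyPair_of_even hx h0 h1 hn hm), sub_right_comm]
    congr 3 <;> ring
  · rw [fareyCoeff_eq G (isFareyPair_of_odd hx h0 h1 hn hm)]
    congr 3 <;> ring

theorem sum_Icc_one_sub (φ : ℤ → ℝ) (k : ℕ) :
    ∑ m ∈ Finset.Icc (1 : ℤ) k, (φ m - φ (m - 1)) = φ k - φ 0 := by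
  induction k with
  | zero => simp
  | succ k ih =>
    have : Finset.Icc (1 : ℤ) ((k + 1 : ℕ) : ℤ) = insert ((k : ℤ) + 1) (Finset.Icc (1 : ℤ) k) := by
      ext i
      simp only [Finset.mem_Icc, Finset.mem_insert]
      omega
    rw [this, Finset.sum_insert (by simp), ih]
    push_cast
    rw [add_sub_cancel_right]
    ring

/-- The parents of the fraction recover m, so the sum over the finite set `E` is a sum over m
without collisions. -/
theorem injOn_intermediate {x : ℝ} (hx : Irrational x) (h0 : 0 < x) (h1 : x < 1) (n : ℕ) :
    Set.InjOn (fun m : ℤ => ((((m * num x (n + 1) + num x n : ℤ) : ℚ) /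
        ((m * den x (n + 1) + den x n : ℤ) : ℚ) : ℚ) : AddCircle (1 : ℚ))) (Set.Ici 1) := by
  intro m hm l hl hml
  dsimp only at hml
  have hq := one_le_den_succ hx n
  rcases Nat.even_or_odd n with hn | hn
  · have := (isFareyPair_of_even hx h0 h1 hn hm).unique
      (by rw [hml]; exact isFareyPair_of_even hx h0 h1 hn hl)
    simp only [Prod.mk.injEq, true_and] at this
    have h : (m - l) * den x (n + 1) = 0 := by linear_combination this.2
    rcases mul_eq_zero.1 h with h | h <;> omega
  · have := (isFareyPair_of_odd hx h0 h1 hn hm).unique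
      (by rw [hml]; exact isFareyPair_of_odd hx h0 h1 hn hl)
    simp only [Prod.mk.injEq] at this
    have h : (m - l) * den x (n + 1) = 0 := by linear_combination this.2.1
    rcases mul_eq_zero.1 h with h | h <;> omega

theorem sum_E_fareyCoeff (G : ℝ → ℝ) {x : ℝ} (hx : Irrational x) (h0 : 0 < x) (h1 : x < 1)
    (n : ℕ) :
    ∑ β ∈ E x (n + 1), fareyCoeff G β =
      weighted G (num x (n + 2)) (den x (n + 2)) - weighted G (num x n) (den x n) -
        partialQuotient x (n + 1) * weighted G (num x (n + 1)) (den x (n + 1)) := by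
  have ha := one_le_partialQuotient hx n
  obtain ⟨k, hk⟩ := Int.eq_ofNat_of_zero_le (by omega : 0 ≤ partialQuotient x (n + 1))
  rw [E, Finset.sum_image fun m hm l hl => injOn_intermediate hx h0 h1 n
    (Finset.mem_Icc.1 hm).1 (Finset.mem_Icc.1 hl).1]
  rw [Finset.sum_congr rfl fun m hm => fareyCoeff_intermediate G hx h0 h1 n (Finset.mem_Icc.1 hm).1]
  rw [Finset.sum_sub_distrib, Finset.sum_const, Int.card_Icc]
  have := sum_Icc_one_sub (fun m => weighted G (m * num x (n + 1) + num x n)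
    (m * den x (n + 1) + den x n)) k
  rw [← hk] at this
  rw [this, hk, num, den, hk]
  simp

/-! ### Telescoping to slopes between convergents -/

/-- The quantity `q_n q_{n-1} (G(p_n / q_n) - G(p_{n-1} / q_{n-1}))`, with indices shifted by one. -/
noncomputable def crossDifference (G : ℝ → ℝ) (x : ℝ) (n : ℕ) : ℝ :=
  den x n * den x (n + 1) * (G (num x (n + 1) / den x (n + 1)) - G (num x n / den x n))

theorem den_mul_sum_E_fareyCoeff (G : ℝ → ℝ) {x : ℝ} (hx : Irrational x) (h0 : 0 < x) (h1 : x < 1)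
    (n : ℕ) :
    den x (n + 1) * ∑ β ∈ E x (n + 1), fareyCoeff G β =
      crossDifference G x (n + 1) + crossDifference G x n := by
  rw [sum_E_fareyCoeff G hx h0 h1]
  simp only [crossDifference, weighted, den, show n + 1 + 1 = n + 2 from rfl]
  push_cast
  ring

theorem partialSum_fareyCoeff (G : ℝ → ℝ) {x : ℝ} (hx : Irrational x) (h0 : 0 < x) (h1 : x < 1)
    (N : ℕ) :
    partialSum (fareyCoeff G) x N = (-1) ^ (N + 1) * crossDifference G x N := by
  induction N with
  -- The cross difference at index 0 vanishes because q_{-1} = 0.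
  | zero => simp [partialSum, crossDifference, den]
  | succ N ih =>
    rw [partialSum, Finset.sum_Icc_succ_top (by omega), ← partialSum, ih, mul_assoc,
      den_mul_sum_E_fareyCoeff G hx h0 h1, Nat.add_sub_cancel]
    ring

/-- The partial sum is the slope of `G` between two consecutive convergents. -/
theorem partialSum_fareyCoeff_eq_slope (G : ℝ → ℝ) {x : ℝ} (hx : Irrational x) (h0 : 0 < x)
    (h1 : x < 1) (n : ℕ) :
    partialSum (fareyCoeff G) x (n + 1) =
      (G (num x (n + 2) / den x (n + 2)) - G (num x (n + 1) / den x (n + 1))) /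
        (num x (n + 2) / den x (n + 2) - num x (n + 1) / den x (n + 1)) := by
  have hd : (num x (n + 2) * den x (n + 1) - num x (n + 1) * den x (n + 2) : ℝ) =
      (-1) ^ (n + 2) := by
    exact_mod_cast num_succ_mul_den_sub x (n + 1)
  have hq : (0 : ℝ) < den x (n + 1) := by exact_mod_cast one_le_den_succ hx n
  have hq' : (0 : ℝ) < den x (n + 2) := by exact_mod_cast one_le_den_succ hx (n + 1)
  rw [partialSum_fareyCoeff G hx h0 h1, crossDifference, div_sub_div _ _ hq'.ne' hq.ne',
    mul_comm (den x (n + 2) : ℝ) (num x (n + 1) : ℝ), hd, div_div_eq_mul_div, eq_div_iff (by simp)]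
  have hs : ((-1 : ℝ) ^ (n + 2)) * (-1) ^ (n + 2) = 1 := by
    rw [← mul_pow]; simp
  linear_combination (den x (n + 1) * den x (n + 2) *
    (G (num x (n + 2) / den x (n + 2)) - G (num x (n + 1) / den x (n + 1)))) * hs

/-- The complete quotient formula writes x as a mediant of the two convergents with positive
weights, so x lies between them and the distances add. -/
theorem abs_convergent_sub_add {x : ℝ} (hx : Irrational x) (h0 : 0 < x) (h1 : x < 1) (n : ℕ) :
    |(num x (n + 2) / den x (n + 2) : ℝ) - x| + |(num x (n + 1) / den x (n + 1) : ℝ) - x| =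
        |(num x (n + 2) / den x (n + 2) : ℝ) - num x (n + 1) / den x (n + 1)| ∧
      |(num x (n + 2) / den x (n + 2) : ℝ) - num x (n + 1) / den x (n + 1)| =
        1 / (den x (n + 2) * den x (n + 1)) := by
  have hd : (num x (n + 2) * den x (n + 1) - num x (n + 1) * den x (n + 2) : ℝ) =
      (-1) ^ (n + 2) := by
    exact_mod_cast num_succ_mul_den_sub x (n + 1)
  have hq : (0 : ℝ) < den x (n + 1) := by exact_mod_cast one_le_den_succ hx n
  have hq' : (0 : ℝ) < den x (n + 2) := by exact_mod_cast one_le_den_succ hx (n + 1)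
  have hr := remainder_pos hx (n + 1)
  have hc := mul_den_add_remainder hx h0 h1 (n + 1)
  set r := remainder x (n + 1)
  set D : ℝ := den x (n + 2) + r * den x (n + 1) with hD
  have hD0 : 0 < D := by positivity
  have hxe : x = (num x (n + 2) + r * num x (n + 1)) / D := by
    rw [eq_div_iff hD0.ne']; exact hc
  have e1 : (num x (n + 2) / den x (n + 2) : ℝ) - x = (-1) ^ (n + 2) * (r / (den x (n + 2) * D)) := by
    nth_rewrite 3 [hxe]
    rw [← hd]
    field_simp
    rw [hD]
    ring
  have e2 : (num x (n + 1) / den x (n + 1) : ℝ) - x = -(-1) ^ (n + 2) * (1 / (den x (n + 1) * D)) := by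
    nth_rewrite 3 [hxe]
    rw [← hd]
    field_simp
    rw [hD]
    ring
  have e3 : (num x (n + 2) / den x (n + 2) : ℝ) - num x (n + 1) / den x (n + 1) =
      (-1) ^ (n + 2) * (1 / (den x (n + 2) * den x (n + 1))) := by
    rw [← hd]
    field_simp
  have hsgn : |(-1 : ℝ) ^ (n + 2)| = 1 := by rw [abs_pow]; simp
  rw [e1, e2, e3]
  simp only [abs_mul, abs_neg, hsgn, one_mul]
  rw [abs_of_pos (by positivity), abs_of_pos (by positivity), abs_of_pos (by positivity)]
  refine ⟨?_, rfl⟩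
  rw [hD]
  field_simp
  ring

theorem tendsto_partialSum_fareyCoeff {G : ℝ → ℝ} {x g : ℝ} (hG : HasDerivAt G g x)
    (hx : Irrational x) (h0 : 0 < x) (h1 : x < 1) :
    Tendsto (partialSum (fareyCoeff G) x) atTop (𝓝 g) := by
  rw [← tendsto_add_atTop_iff_nat 1]
  simp only [partialSum_fareyCoeff_eq_slope G hx h0 h1]
  have hq : ∀ n, (0 : ℝ) < den x (n + 1) := fun n => by exact_mod_cast one_le_den_succ hx n
  have hone : ∀ n, (1 : ℝ) ≤ den x (n + 1) := fun n => by exact_mod_cast one_le_den_succ hx n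
  have hden : ∀ n : ℕ, 1 / (den x (n + 2) * den x (n + 1) : ℝ) ≤ 1 / ((n : ℝ) + 1) := by
    intro n
    have h2 : ((n + 1 : ℕ) : ℝ) ≤ den x (n + 2) := by exact_mod_cast le_den_succ hx (n + 1)
    push_cast at h2
    refine one_div_le_one_div_of_le (by positivity) (h2.trans ?_)
    exact le_mul_of_one_le_right (hq (n + 1)).le (hone n)
  have hlim := tendsto_one_div_add_atTop_nhds_zero_nat (𝕜 := ℝ)
  refine tendsto_straddled_slope hG ?_ ?_ (Eventually.of_forall fun n => ?_)
    (Eventually.of_forall fun n => (abs_convergent_sub_add hx h0 h1 n).1.le)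
  · refine tendsto_iff_norm_sub_tendsto_zero.2
      (squeeze_zero (fun _ => norm_nonneg _) (fun n => ?_) hlim)
    obtain ⟨k1, k2⟩ := abs_convergent_sub_add hx h0 h1 n
    rw [Real.norm_eq_abs]
    linarith [hden n, abs_nonneg ((num x (n + 1) / den x (n + 1) : ℝ) - x)]
  · refine tendsto_iff_norm_sub_tendsto_zero.2
      (squeeze_zero (fun _ => norm_nonneg _) (fun n => ?_) hlim)
    obtain ⟨k1, k2⟩ := abs_convergent_sub_add hx h0 h1 n
    rw [Real.norm_eq_abs]
    linarith [hden n, abs_nonneg ((num x (n + 2) / den x (n + 2) : ℝ) - x)]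
  · rw [← sub_ne_zero, ← abs_pos, (abs_convergent_sub_add hx h0 h1 n).2]
    exact one_div_pos.2 (mul_pos (hq (n + 1)) (hq n))

end IntermediateConvergents

/-! ### The theorem on the circle -/

open IntermediateConvergents in
theorem theorem2 (F : UnitAddCircle → EReal) (hF : Measurable F)
    (hfin : ∀ᵐ α : UnitAddCircle ∂volume, F α ≠ ⊥ ∧ F α ≠ ⊤) :
    ∃ c : AddCircle (1 : ℚ) → ℝ,
      ∀ᵐ α : UnitAddCircle ∂volume, Irrational (IntermediateConvergents.rep α) →
        Tendsto
          (fun N : ℕ =>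
            ((IntermediateConvergents.partialSum c (IntermediateConvergents.rep α) N : ℝ) : EReal))
          atTop (𝓝 (F α)) := by
  -- F is lifted to a periodic real function; `toReal` alters it only where it is infinite, a null
  -- set.
  have hf : Measurable fun y : ℝ => (F (y : UnitAddCircle)).toReal :=
    (hF.comp AddCircle.measurable_mk').ereal_toReal
  obtain ⟨G, hG⟩ := exists_ae_hasDerivAt hf
  refine ⟨fareyCoeff G, ?_⟩
  filter_upwards [hfin, quasiMeasurePreserving_rep.ae hG] with α ⟨hbot, htop⟩ hα hirr
  have hmem : rep α ∈ Set.Ico (0 : ℝ) (0 + 1) := (AddCircle.equivIco (1 : ℝ) 0 α).2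
  rw [zero_add] at hmem
  have hcoe : ((rep α : ℝ) : UnitAddCircle) = α := AddCircle.coe_equivIco
  have := tendsto_partialSum_fareyCoeff hα hirr (lt_of_le_of_ne hmem.1 hirr.ne_zero.symm) hmem.2
  rw [hcoe] at this
  rw [← EReal.coe_toReal htop hbot]
  exact (continuous_coe_real_ereal.tendsto _).comp this
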